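/- Let $n, r_1, r_2$ be integers with $0\le r_1<r_2\le n/2$. For $x\in\{0,1\}^n$ let $|x|$ be its Hamming weight, let $S(n,i)=\{x\in\{0,1\}^n:|x|=i\}$, and let $B=\bigcup_{i=r_1}^{r_2}S(n,i)$. Let $A$ be the adjacency matrix of the subgraph induced by $B$ in the Hamming cube (the graph on $\{0,1\}^n$ in which two points are adjacent iff their Hamming distance is $1$); it acts on the functions $f:B\to\mathbb R$. Identify points of $\{0,1\}^n$ with subsets of $\{1,\dots,n\}$. For $0\le j\le i\le n/2$, let $U_j$ be the span of the functions $g_z$, $|z|\le j$, on $S(n,i)$, where $g_z(x)=1$ if $z\subseteq x$ and $g_z(x)=0$ otherwise. Let $V_0=U_0$ and $V_j=U_j\cap U_{j-1}^{\perp}$ for $1\le j\le i$ (orthogonality with respect to $\langle f,g\rangle=\sum_{x\in S(n,i)} f(x)g(x)$); $V_j$ is called the $j$-th eigenspace of $S(n,i)$. For $0\le t\le r_2$ write $t'=\max\{t,r_1\}$, let $M_t$ be the $(r_2-t'+1)\times(r_2-t'+1)$ symmetric tridiagonal matrix with zero diagonal and with off-diagonal entries $\sqrt{\lambda_{t'-t+2}},\sqrt{\lambda_{t'-t+3}},\dots,\sqrt{\lambda_{r_2-t+1}}$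 (from top to bottom), where $\lambda_k=(k-1)(n-2t-k+2)$, and let $\Lambda_t$ be the set of real eigenvalues of $M_t$. Put $\binom{n}{-1}=0$. Then there are linear spaces $W_t(\lambda)$ of functions on $B$, for $0\le t\le r_2$ and $\lambda\in\Lambda_t$, such that the following holds. 1. For each $t=0,\dots,r_2$, the set $\Lambda_t$ consists of exactly $r_2-t'+1$ distinct real numbers, and for each $\lambda\in\Lambda_t$ we have $Af=\lambda f$ for all $f\in W_t(\lambda)$, and $\dim W_t(\lambda)=\binom nt-\binom n{t-1}$. 2. Let $0\le t\le r_2$ and $\lambda\in\Lambda_t$. For every $f\in W_t(\lambda)$ and every $i$ with $t'\le i\le r_2$, the restriction of $f$ to $S(n,i)$ lies in the $t$-th eigenspace $V_t$ of $S(n,i)$. Furthermore, every $f\in W_t(\lambda)$ vanishes at all points $x\in B$ with $|x|<t'$. The restrictions of the functions in $W_t(\lambda)$ to $S(n,t')$ span the $t$-th eigenspace $V_t$ of $S(n,t')$. Moreover, a function $f\in W_t(\lambda)$ is determined by its restriction to $S(n,t')$. 3. A real number $\lambda$ is an eigenvalue of $A$ if and only if $\lambda\in\bigcup_{t=0}^{r_2}\Lambda_t$.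 Its multiplicity as an eigenvalue of $A$ is $$m(\lambda)=\sum_{0\le t\le r_2,\ \lambda\in\Lambda_t}\left(\binom nt-\binom n{t-1}\right).$$ -/

import Mathlib

/-- The Hamming weight `|x|` of a point of the cube `{0,1}ⁿ` (with `true` for `1`): its Hamming
distance from the zero vector. -/
def hammingWeight {n : ℕ} (x : Fin n → Bool) : ℕ :=
  hammingDist x (fun _ => false)

/-- The Hamming cube `{0,1}ⁿ` as a graph: two points are adjacent iff they are at Hamming
distance `1`. -/
def hammingCube (n : ℕ) : SimpleGraph (Fin n → Bool) where
  Adj x y := hammingDist x y = 1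
  symm := ⟨fun x y h => by rw [hammingDist_comm]; exact h⟩
  loopless := ⟨fun x h => by simp at h⟩

instance hammingCube.decidableAdj (n : ℕ) : DecidableRel (hammingCube n).Adj :=
  fun x y => inferInstanceAs (Decidable (hammingDist x y = 1))

/-- The Hamming sphere `S(n,i)` of radius `i` around `0`. -/
def hammingSphere (n i : ℕ) : Finset (Fin n → Bool) :=
  Finset.univ.filter fun x => hammingWeight x = i

/-- The union `B(n,r₁,r₂)` of the concentric Hamming spheres `S(n,i)`, `r₁ ≤ i ≤ r₂`. -/
def hammingShell (n r₁ r₂ : ℕ) : Finset (Fin n → Bool) :=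
  (Finset.Icc r₁ r₂).biUnion (hammingSphere n)

theorem hammingSphere_subset_shell {n r₁ r₂ i : ℕ} (h₁ : r₁ ≤ i) (h₂ : i ≤ r₂) :
    hammingSphere n i ⊆ hammingShell n r₁ r₂ :=
  Finset.subset_biUnion_of_mem (hammingSphere n) (Finset.mem_Icc.mpr ⟨h₁, h₂⟩)

/-- The adjacency matrix `A(n,r₁,r₂)` of the subgraph of the Hamming cube induced by the vertices
in `B(n,r₁,r₂)`. -/
def shellAdjMatrix (n r₁ r₂ : ℕ) :
    Matrix (hammingShell n r₁ r₂) (hammingShell n r₁ r₂) ℝ :=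
  ((hammingCube n).comap (Subtype.val : hammingShell n r₁ r₂ → (Fin n → Bool))).adjMatrix ℝ

/-- The restriction of functions on `B(n,r₁,r₂)` to one of its spheres `S(n,i)`. -/
def restrictToSphere (n : ℕ) {r₁ r₂ i : ℕ} (h₁ : r₁ ≤ i) (h₂ : i ≤ r₂) :
    (hammingShell n r₁ r₂ → ℝ) →ₗ[ℝ] (hammingSphere n i → ℝ) :=
  LinearMap.funLeft ℝ ℝ fun x => ⟨x.1, hammingSphere_subset_shell h₁ h₂ x.2⟩

/-- The function `g_z` on `S(n,i)`: the indicator of `z ⊆ x`, for subsets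
identified with their indicator vectors. -/
def containmentFun (n i : ℕ) (z : Fin n → Bool) : hammingSphere n i → ℝ :=
  fun x => if ∀ k, z k = true → x.1 k = true then 1 else 0

/-- The span `U_j` of the functions `g_z` with `|z| ≤ j` on `S(n,i)`. -/
def johnsonFiltration (n i j : ℕ) : Submodule ℝ (hammingSphere n i → ℝ) :=
  Submodule.span ℝ {g | ∃ z : Fin n → Bool, hammingWeight z ≤ j ∧ g = containmentFun n i z}

/-- The orthogonal complement of a space of functions on a finite set, with respect to the
inner product `⟨f, g⟩ = ∑ x, f x * g x`. -/
def functionOrthogonal {X : Type*} [Fintype X] (U : Submodule ℝ (X → ℝ)) :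
    Submodule ℝ (X → ℝ) where
  carrier := {f | ∀ g ∈ U, ∑ x, f x * g x = 0}
  add_mem' := by
    intro a b ha hb g hg
    simp [add_mul, Finset.sum_add_distrib, ha g hg, hb g hg]
  zero_mem' := by
    intro g _
    simp
  smul_mem' := by
    intro c a ha g hg
    simp [mul_assoc, ← Finset.mul_sum, ha g hg]

/-- The `j`-th eigenspace `V_j` of the Johnson scheme on `S(n,i)` (for `0 ≤ j ≤ i ≤ n/2`):
`V_0 = U_0` and `V_j = U_j ∩ U_{j-1}^⊥` for `j ≥ 1`. -/
def johnsonEigenspace (n i : ℕ) : ℕ → Submodule ℝ (hammingSphere n i → ℝ)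
  | 0 => johnsonFiltration n i 0
  | j + 1 => johnsonFiltration n i (j + 1) ⊓ functionOrthogonal (johnsonFiltration n i j)

/-- `λ_k = (k-1)(n-2t-k+2)`, as a real number. -/
def lambdaCoeff (n t k : ℕ) : ℝ :=
  ((k : ℝ) - 1) * ((n : ℝ) - 2 * t - k + 2)

/-- The symmetric tridiagonal matrix `M_t` of size `r₂ - t' + 1`, with `t' = max t r₁`, zero
diagonal, and off-diagonal entries `√λ_{t'-t+2}, …, √λ_{r₂-t+1}` from top to bottom. -/
noncomputable def tridiagM (n r₁ r₂ t : ℕ) :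
    Matrix (Fin (r₂ - max t r₁ + 1)) (Fin (r₂ - max t r₁ + 1)) ℝ :=
  Matrix.of fun i j =>
    if (j : ℕ) = i + 1 then √(lambdaCoeff n t (max t r₁ - t + 2 + i))
    else if (i : ℕ) = j + 1 then √(lambdaCoeff n t (max t r₁ - t + 2 + j))
    else 0

/-- The set `Λ_t` of the eigenvalues of `M_t`. -/
def eigenSet (n r₁ r₂ t : ℕ) : Set ℝ :=
  {l | Module.End.HasEigenvalue (Matrix.toLin' (tridiagM n r₁ r₂ t)) l}

/-- The number `C(n,t) - C(n,t-1)`, where `C(n,-1) = 0`. -/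
def binomDiff (n t : ℕ) : ℤ :=
  (n.choose t : ℤ) - (if t = 0 then 0 else (n.choose (t - 1) : ℤ))

open Classical in
/-- The sum of `C(n,t) - C(n,t-1)` over all `t ∈ {0,…,r₂}` with `l ∈ Λ_t`. -/
noncomputable def multiplicitySum (n r₁ r₂ : ℕ) (l : ℝ) : ℤ :=
  ∑ t ∈ (Finset.range (r₂ + 1)).filter (fun t => l ∈ eigenSet n r₁ r₂ t), binomDiff n t

/-! The neighbours of a point of the cube lie one level up or one level down, so the adjacency
operator of the shell is `U + D` applied to functions extended by zero, where `U = cubeUp` and its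
adjoint `D = cubeDown` satisfy the `sl₂` relation `DU - UD = n - 2|x|` (`cubeDown_cubeUp`). A
function `h` on level `t` with `D h = 0` generates a string `h, U h, U² h, …` on which `D` acts by
explicit scalars (`cubeDown_cubeUp_pow`). Such harmonic functions form a space of dimension `C(n,t)
- C(n,t-1)`, and `U^(i-t)` carries it onto the eigenspace `V_t` of `S(n,i)`
(`johnsonEigenspace_eq`).

On the part of one string lying in the shell, `U + D` is a tridiagonal matrix that does not depend
on `h`. Normalising the levels makes it symmetric and turns it into `M_t`. Its off-diagonal entries
are nonzero, so an eigenvector is determined by its first entry and the spectrum is simple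
(`ncard_eigenSet`). An eigenvector of `M_t` supplies radial coefficients `c`
(`exists_radial_coeff`), and `W_t(λ)` consists of the functions equal to `c i • U^(i-t) h` on
`S(n,i)`, with `h` harmonic of degree `t`.

Strings of different degree are orthogonal, so the sum `m(λ)` bounds the multiplicity of `λ` from
below. The numbers `m(λ)` add up to the number of points of the shell (`sum_multiplicitySum`), which
also bounds the sum of all multiplicities, so every one of these bounds is an equality and there are
no further eigenvalues. -/

/-! ### Raising and lowering operators on the cube -/

/-- The raising operator on functions on the cube: `(U f)(x)` is the sum of `f` over the points
covered by `x`. -/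
def cubeUp (n : ℕ) : ((Fin n → Bool) → ℝ) →ₗ[ℝ] ((Fin n → Bool) → ℝ) where
  toFun f x := ∑ k, if x k = true then f (Function.update x k false) else 0
  map_add' f g := by
    ext x
    simp only [Pi.add_apply, ← Finset.sum_add_distrib]
    exact Finset.sum_congr rfl fun k _ => by split_ifs <;> simp
  map_smul' c f := by
    ext x
    simp only [Pi.smul_apply, smul_eq_mul, RingHom.id_apply, Finset.mul_sum]
    exact Finset.sum_congr rfl fun k _ => by split_ifs <;> simp

/-- The lowering operator on functions on the cube: `(D f)(x)` is the sum of `f` over the points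
covering `x`. -/
def cubeDown (n : ℕ) : ((Fin n → Bool) → ℝ) →ₗ[ℝ] ((Fin n → Bool) → ℝ) where
  toFun f x := ∑ k, if x k = true then 0 else f (Function.update x k true)
  map_add' f g := by
    ext x
    simp only [Pi.add_apply, ← Finset.sum_add_distrib]
    exact Finset.sum_congr rfl fun k _ => by split_ifs <;> simp
  map_smul' c f := by
    ext x
    simp only [Pi.smul_apply, smul_eq_mul, RingHom.id_apply, Finset.mul_sum]
    exact Finset.sum_congr rfl fun k _ => by split_ifs <;> simp

theorem cubeUp_apply {n : ℕ} (f : (Fin n → Bool) → ℝ) (x : Fin n → Bool) :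
    cubeUp n f x = ∑ k, if x k = true then f (Function.update x k false) else 0 := rfl

theorem cubeDown_apply {n : ℕ} (f : (Fin n → Bool) → ℝ) (x : Fin n → Bool) :
    cubeDown n f x = ∑ k, if x k = true then 0 else f (Function.update x k true) := rfl

theorem hammingWeight_eq_sum {n : ℕ} (x : Fin n → Bool) :
    hammingWeight x = ∑ k, if x k = true then 1 else 0 := by
  simp [hammingWeight, hammingDist]

theorem hammingWeight_le {n : ℕ} (x : Fin n → Bool) : hammingWeight x ≤ n := by
  simpa [hammingWeight] using hammingDist_le_card_fintype (x := x) (y := fun _ => false)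

theorem hammingWeight_update_true {n : ℕ} {x : Fin n → Bool} {k : Fin n} (hk : ¬ x k = true) :
    hammingWeight (Function.update x k true) = hammingWeight x + 1 := by
  rw [hammingWeight_eq_sum, hammingWeight_eq_sum,
    ← Finset.add_sum_erase _ _ (Finset.mem_univ k), ← Finset.add_sum_erase (a := k) Finset.univ
      (fun k => if x k = true then 1 else 0) (Finset.mem_univ k)]
  have : ∑ l ∈ Finset.univ.erase k, (if Function.update x k true l = true then 1 else 0)
      = ∑ l ∈ Finset.univ.erase k, (if x l = true then 1 else 0) :=
    Finset.sum_congr rfl fun l hl => by rw [Function.update_of_ne (Finset.ne_of_mem_erase hl)]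
  rw [this]
  simp [hk, add_comm]

theorem hammingWeight_update_false {n : ℕ} {x : Fin n → Bool} {k : Fin n} (hk : x k = true) :
    hammingWeight (Function.update x k false) + 1 = hammingWeight x := by
  have := hammingWeight_update_true (x := Function.update x k false) (k := k) (by simp)
  rw [← this, Function.update_idem, ← hk, Function.update_eq_self]

/-- Flips of two distinct coordinates commute, so those terms of `DU` and `UD` cancel. What remains
is `f x` once for each zero of `x` and `-f x` once for each one. -/
theorem cubeDown_cubeUp {n : ℕ} (f : (Fin n → Bool) → ℝ) (x : Fin n → Bool) :
    cubeDown n (cubeUp n f) x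
      = cubeUp n (cubeDown n f) x + ((n : ℝ) - 2 * hammingWeight x) * f x := by
  have key : ∀ k l : Fin n,
      (if x k = true then 0 else if Function.update x k true l = true then
          f (Function.update (Function.update x k true) l false) else 0)
      = (if x l = true then (if Function.update x l false k = true then 0 else
          f (Function.update (Function.update x l false) k true)) else 0)
        + (if k = l then (if x k = true then - f x else f x) else 0) := by
    intro k l
    by_cases hkl : k = l
    · subst hkl
      by_cases hx : x k = true
      · have : Function.update x k true = x := by rw [← hx, Function.update_eq_self]
        simp [hx, this]
      · have hx' : x k = false := by simpa using hx
        have : Function.update x k false = x := by rw [← hx', Function.update_eq_self]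
        simp [hx', this]
    · rw [Function.update_of_ne (Ne.symm hkl), Function.update_of_ne hkl,
        Function.update_comm hkl]
      split_ifs <;> simp
  have hw : ((n : ℝ) - 2 * hammingWeight x) * f x
      = ∑ k, (if x k = true then - f x else f x) := by
    rw [hammingWeight_eq_sum]
    push_cast
    have : (n : ℝ) = ∑ _k : Fin n, (1 : ℝ) := by simp
    rw [this, Finset.mul_sum, ← Finset.sum_sub_distrib, Finset.sum_mul]
    exact Finset.sum_congr rfl fun k _ => by split_ifs <;> ring
  rw [hw, cubeDown_apply, cubeUp_apply]
  simp only [cubeUp_apply, cubeDown_apply]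
  have h1 : ∀ k, (if x k = true then (0 : ℝ) else ∑ l, if Function.update x k true l = true then
      f (Function.update (Function.update x k true) l false) else 0)
      = ∑ l, (if x k = true then 0 else if Function.update x k true l = true then
          f (Function.update (Function.update x k true) l false) else 0) := by
    intro k; split_ifs <;> simp
  have h2 : ∀ l, (if x l = true then ∑ k, (if Function.update x l false k = true then (0 : ℝ) else
          f (Function.update (Function.update x l false) k true)) else 0)
      = ∑ k, (if x l = true then (if Function.update x l false k = true then 0 else
          f (Function.update (Function.update x l false) k true)) else 0) := by
    intro l; split_ifs <;> simp
  simp_rw [h1, h2, key, Finset.sum_add_distrib]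
  rw [Finset.sum_comm]
  simp

/-- For each coordinate, the involution flipping it exchanges the terms of the two sums. -/
theorem sum_cubeUp_mul {n : ℕ} (f g : (Fin n → Bool) → ℝ) :
    ∑ x, cubeUp n f x * g x = ∑ x, f x * cubeDown n g x := by
  simp only [cubeUp_apply, cubeDown_apply, Finset.sum_mul, Finset.mul_sum]
  rw [Finset.sum_comm]
  conv_rhs => rw [Finset.sum_comm]
  refine Finset.sum_congr rfl fun k _ => ?_
  have hinv : Function.Involutive fun x : Fin n → Bool => Function.update x k (!x k) := by
    intro x; simp
  refine Fintype.sum_equiv hinv.toPerm _ _ fun x => ?_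
  simp only [Function.Involutive.coe_toPerm]
  by_cases hx : x k = true
  · have : Function.update x k true = x := by rw [← hx, Function.update_eq_self]
    simp [hx, this]
  · simp [hx]

theorem sum_cubeUp_pow_mul {n : ℕ} (m : ℕ) (f g : (Fin n → Bool) → ℝ) :
    ∑ x, (cubeUp n ^ m) f x * g x = ∑ x, f x * (cubeDown n ^ m) g x := by
  induction m generalizing g with
  | zero => simp
  | succ m ih =>
    rw [pow_succ', pow_succ, Module.End.mul_apply, Module.End.mul_apply, sum_cubeUp_mul, ih]

/-! ### Layers and strings over harmonic functions -/

/-- The functions on the cube supported on the sphere of radius `i`. -/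
def cubeLayer (n i : ℕ) : Submodule ℝ ((Fin n → Bool) → ℝ) where
  carrier := {f | ∀ x, hammingWeight x ≠ i → f x = 0}
  add_mem' := fun ha hb x hx => by simp [ha x hx, hb x hx]
  zero_mem' := fun _ _ => rfl
  smul_mem' := fun c a ha x hx => by simp [ha x hx]

theorem cubeUp_mem_layer {n i : ℕ} {f : (Fin n → Bool) → ℝ} (hf : f ∈ cubeLayer n i) :
    cubeUp n f ∈ cubeLayer n (i + 1) := fun x hx => by
  rw [cubeUp_apply]
  refine Finset.sum_eq_zero fun k _ => ?_
  split_ifs with hk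
  · exact hf _ fun h => hx (by rw [← hammingWeight_update_false hk, h])
  · rfl

theorem cubeUp_pow_mem_layer {n i : ℕ} {f : (Fin n → Bool) → ℝ} (hf : f ∈ cubeLayer n i)
    (m : ℕ) : (cubeUp n ^ m) f ∈ cubeLayer n (i + m) := by
  induction m with
  | zero => simpa using hf
  | succ m ih => rw [pow_succ', Module.End.mul_apply]; exact cubeUp_mem_layer ih

theorem cubeDown_mem_layer {n i : ℕ} {f : (Fin n → Bool) → ℝ} (hf : f ∈ cubeLayer n (i + 1)) :
    cubeDown n f ∈ cubeLayer n i := fun x hx => by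
  rw [cubeDown_apply]
  refine Finset.sum_eq_zero fun k _ => ?_
  split_ifs with hk
  · rfl
  · exact hf _ fun h => hx (by rw [hammingWeight_update_true hk] at h; omega)

theorem cubeDown_eq_zero_of_layer_zero {n : ℕ} {f : (Fin n → Bool) → ℝ}
    (hf : f ∈ cubeLayer n 0) : cubeDown n f = 0 := by
  ext x
  rw [cubeDown_apply]
  refine Finset.sum_eq_zero fun k _ => ?_
  split_ifs with hk
  · rfl
  · exact hf _ (by rw [hammingWeight_update_true hk]; omega)

theorem cubeDown_cubeUp_of_mem_layer {n i : ℕ} {f : (Fin n → Bool) → ℝ}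
    (hf : f ∈ cubeLayer n i) :
    cubeDown n (cubeUp n f) = cubeUp n (cubeDown n f) + ((n : ℝ) - 2 * i) • f := by
  ext x
  rw [cubeDown_cubeUp, Pi.add_apply, Pi.smul_apply, smul_eq_mul]
  by_cases hx : hammingWeight x = i
  · rw [hx]
  · rw [hf x hx]; simp

/-- The harmonic functions of degree `t`: functions on the sphere of radius `t` killed by the
lowering operator. -/
def cubeHarmonic (n t : ℕ) : Submodule ℝ ((Fin n → Bool) → ℝ) :=
  cubeLayer n t ⊓ LinearMap.ker (cubeDown n)

/-- Moving `D` past each `U` collects the scalars `n - 2(t+j)` for `j = 0, …, k`. Their sum is the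
stated coefficient, because the last term contains `D h = 0`. -/
theorem cubeDown_cubeUp_pow {n t : ℕ} {h : (Fin n → Bool) → ℝ} (hh : h ∈ cubeHarmonic n t)
    (k : ℕ) : cubeDown n ((cubeUp n ^ (k + 1)) h)
      = (((k : ℝ) + 1) * (n - 2 * t - k)) • (cubeUp n ^ k) h := by
  have hD : cubeDown n h = 0 := hh.2
  induction k with
  | zero =>
    rw [zero_add, pow_one, cubeDown_cubeUp_of_mem_layer hh.1, hD]
    simp
  | succ k ih =>
    rw [pow_succ', Module.End.mul_apply,
      cubeDown_cubeUp_of_mem_layer (cubeUp_pow_mem_layer hh.1 (k + 1)), ih, map_smul,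
      ← Module.End.mul_apply, ← pow_succ', ← add_smul]
    congr 1
    push_cast
    ring

theorem cubeDown_pow_cubeUp_pow_eq_zero {n t : ℕ} {h : (Fin n → Bool) → ℝ}
    (hh : h ∈ cubeHarmonic n t) {k m : ℕ} (hkm : k < m) :
    (cubeDown n ^ m) ((cubeUp n ^ k) h) = 0 := by
  induction k generalizing m with
  | zero =>
    obtain ⟨m, rfl⟩ : ∃ m', m = m' + 1 := ⟨m - 1, by omega⟩
    have hD : cubeDown n h = 0 := hh.2
    rw [pow_succ, Module.End.mul_apply, pow_zero, Module.End.one_apply, hD, map_zero]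
  | succ k ih =>
    obtain ⟨m, rfl⟩ : ∃ m', m = m' + 1 := ⟨m - 1, by omega⟩
    rw [pow_succ, Module.End.mul_apply, cubeDown_cubeUp_pow hh, map_smul, ih (by omega),
      smul_zero]

/-- Applying `D` descends the string one step at a time, and the scalars met on the way are nonzero
as long as `2t + k ≤ n`. -/
theorem eq_zero_of_cubeUp_pow_eq_zero {n t : ℕ} {h : (Fin n → Bool) → ℝ}
    (hh : h ∈ cubeHarmonic n t) {k : ℕ} (hk : 2 * t + k ≤ n) (h0 : (cubeUp n ^ k) h = 0) :
    h = 0 := by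
  induction k with
  | zero => simpa using h0
  | succ k ih =>
    have h1 := cubeDown_cubeUp_pow hh k
    rw [h0, map_zero, eq_comm, smul_eq_zero] at h1
    refine ih (by omega) (h1.resolve_left ?_)
    have : (2 * (t : ℝ) + (k + 1) ≤ n) := by exact_mod_cast hk
    exact mul_ne_zero (by positivity) (by linarith)

theorem eq_zero_of_sum_mul_self {X : Type*} [Fintype X] {f : X → ℝ}
    (h : ∑ x, f x * f x = 0) : f = 0 := by
  rw [Finset.sum_eq_zero_iff_of_nonneg fun x _ => mul_self_nonneg _] at h
  ext x
  exact mul_self_eq_zero.mp (h x (Finset.mem_univ x))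

/-- Pairing the commutation relation with `f` gives `‖D f‖² + (n - 2i)‖f‖² = 0`, with a positive
coefficient below the middle level. -/
theorem eq_zero_of_cubeDown_cubeUp {n i : ℕ} (hi : 2 * i < n) {f : (Fin n → Bool) → ℝ}
    (hf : f ∈ cubeLayer n i) (h : cubeDown n (cubeUp n f) = 0) : f = 0 := by
  have h1 := cubeDown_cubeUp_of_mem_layer hf
  rw [h] at h1
  have h2 : ∑ x, cubeDown n f x * cubeDown n f x + ((n : ℝ) - 2 * i) * ∑ x, f x * f x = 0 := by
    rw [← sum_cubeUp_mul, Finset.mul_sum, ← Finset.sum_add_distrib]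
    refine Finset.sum_eq_zero fun x _ => ?_
    have := congrFun h1 x
    simp only [Pi.zero_apply, Pi.add_apply, Pi.smul_apply, smul_eq_mul] at this
    linear_combination (-f x) * this
  have h3 : 0 ≤ ∑ x, cubeDown n f x * cubeDown n f x :=
    Finset.sum_nonneg fun x _ => mul_self_nonneg _
  have h4 : 0 ≤ ∑ x, f x * f x := Finset.sum_nonneg fun x _ => mul_self_nonneg _
  have h5 : (2 * (i : ℝ) < n) := by exact_mod_cast hi
  exact eq_zero_of_sum_mul_self (by nlinarith)

theorem exists_cubeDown_cubeUp_eq {n i : ℕ} (hi : 2 * i < n) {g : (Fin n → Bool) → ℝ}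
    (hg : g ∈ cubeLayer n i) : ∃ f ∈ cubeLayer n i, cubeDown n (cubeUp n f) = g := by
  let T : cubeLayer n i →ₗ[ℝ] cubeLayer n i :=
    (cubeDown n ∘ₗ cubeUp n).restrict fun f hf => cubeDown_mem_layer (cubeUp_mem_layer hf)
  have hT : Function.Injective T := by
    rw [← LinearMap.ker_eq_bot, LinearMap.ker_eq_bot']
    intro f hf
    exact Subtype.ext (eq_zero_of_cubeDown_cubeUp hi f.2 (congrArg Subtype.val hf))
  obtain ⟨f, hf⟩ := LinearMap.injective_iff_surjective.mp hT ⟨g, hg⟩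
  exact ⟨f, f.2, congrArg Subtype.val hf⟩

/-- `DU` is injective on a finite-dimensional layer, hence bijective. Choosing `g` with `DU g = D f`
makes `f - U g` harmonic. -/
theorem cubeLayer_succ_eq_sup {n i : ℕ} (hi : 2 * i < n) :
    cubeHarmonic n (i + 1) ⊔ (cubeLayer n i).map (cubeUp n) = cubeLayer n (i + 1) := by
  refine le_antisymm (sup_le inf_le_left ?_) fun f hf => ?_
  · rintro _ ⟨g, hg, rfl⟩
    exact cubeUp_mem_layer hg
  · obtain ⟨g, hg, h⟩ := exists_cubeDown_cubeUp_eq hi (cubeDown_mem_layer hf)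
    refine Submodule.mem_sup.mpr ⟨f - cubeUp n g, ⟨sub_mem hf (cubeUp_mem_layer hg), ?_⟩,
      cubeUp n g, ⟨g, hg, rfl⟩, sub_add_cancel _ _⟩
    change cubeDown n _ = 0
    rw [map_sub, h, sub_self]

/-! ### Dimensions of layers and of harmonic spaces -/

theorem card_hammingSphere (n i : ℕ) : (hammingSphere n i).card = n.choose i := by
  have hc := Finset.card_powersetCard i (Finset.univ : Finset (Fin n))
  rw [Finset.card_univ, Fintype.card_fin] at hc
  rw [← hc]
  refine Finset.card_nbij' (fun x => Finset.univ.filter fun k => x k = true)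
    (fun s k => decide (k ∈ s)) ?_ ?_ ?_ ?_
  · intro x hx
    simpa [hammingSphere, Finset.mem_powersetCard, hammingWeight_eq_sum] using hx
  · intro s hs
    simpa [hammingSphere, Finset.mem_powersetCard, hammingWeight_eq_sum] using hs
  · intro x _
    ext k
    simp
  · intro s _
    ext k
    simp

/-- Restriction of functions on the cube to a sphere. -/
def cubeRestrict (n i : ℕ) : ((Fin n → Bool) → ℝ) →ₗ[ℝ] (hammingSphere n i → ℝ) :=
  LinearMap.funLeft ℝ ℝ Subtype.val

theorem mem_hammingSphere {n i : ℕ} {x : Fin n → Bool} :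
    x ∈ hammingSphere n i ↔ hammingWeight x = i := by simp [hammingSphere]

theorem cubeRestrict_injOn {n i : ℕ} {f : (Fin n → Bool) → ℝ} (hf : f ∈ cubeLayer n i)
    (h : cubeRestrict n i f = 0) : f = 0 := by
  ext x
  by_cases hx : hammingWeight x = i
  · exact congrFun h ⟨x, mem_hammingSphere.mpr hx⟩
  · exact hf x hx

theorem finrank_cubeLayer (n i : ℕ) : Module.finrank ℝ (cubeLayer n i) = n.choose i := by
  have hinj : Function.Injective ((cubeRestrict n i).domRestrict (cubeLayer n i)) := by
    rw [← LinearMap.ker_eq_bot, LinearMap.ker_eq_bot']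
    exact fun f hf => Subtype.ext (cubeRestrict_injOn f.2 hf)
  have hsurj : Function.Surjective ((cubeRestrict n i).domRestrict (cubeLayer n i)) := by
    intro g
    refine ⟨⟨fun x => if hx : x ∈ hammingSphere n i then g ⟨x, hx⟩ else 0, fun x hx => ?_⟩, ?_⟩
    · exact dif_neg (by rwa [mem_hammingSphere])
    · ext x
      exact dif_pos x.2
  rw [(LinearEquiv.ofBijective _ ⟨hinj, hsurj⟩).finrank_eq, Module.finrank_fintype_fun_eq_card,
    Fintype.card_coe, card_hammingSphere]

theorem finrank_cubeHarmonic {n t : ℕ} (ht : 2 * t ≤ n) :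
    (Module.finrank ℝ (cubeHarmonic n t) : ℤ) = binomDiff n t := by
  cases t with
  | zero =>
    have : cubeHarmonic n 0 = cubeLayer n 0 :=
      inf_eq_left.mpr fun f hf => cubeDown_eq_zero_of_layer_zero hf
    rw [this, finrank_cubeLayer]
    simp [binomDiff]
  | succ i =>
    have hi : 2 * i < n := by omega
    have hdisj : cubeHarmonic n (i + 1) ⊓ (cubeLayer n i).map (cubeUp n) = ⊥ := by
      rw [eq_bot_iff]
      rintro _ ⟨hh, g, hg, rfl⟩
      rw [eq_zero_of_cubeDown_cubeUp hi hg hh.2, map_zero]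
      exact Submodule.zero_mem _
    have hinj : Function.Injective ((cubeUp n).domRestrict (cubeLayer n i)) := by
      rw [← LinearMap.ker_eq_bot, LinearMap.ker_eq_bot']
      intro f hf
      refine Subtype.ext (eq_zero_of_cubeDown_cubeUp hi f.2 ?_)
      rw [show cubeUp n f.1 = 0 from hf, map_zero]
    have hup : Module.finrank ℝ ((cubeLayer n i).map (cubeUp n)) = n.choose i := by
      rw [← LinearMap.range_domRestrict, LinearMap.finrank_range_of_inj hinj, finrank_cubeLayer]
    have := Submodule.finrank_sup_add_finrank_inf_eq (cubeHarmonic n (i + 1))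
      ((cubeLayer n i).map (cubeUp n))
    rw [hdisj, cubeLayer_succ_eq_sup hi, finrank_cubeLayer, hup, finrank_bot] at this
    simp only [binomDiff, Nat.add_eq_zero_iff, one_ne_zero, and_false, if_false,
      Nat.add_sub_cancel]
    omega

/-! ### The Johnson eigenspaces as images of harmonic functions -/

theorem hammingWeight_eq_add_card_sdiff {n : ℕ} {z x : Fin n → Bool}
    (h : ∀ k, z k = true → x k = true) :
    hammingWeight x
      = hammingWeight z + (Finset.univ.filter fun k => x k = true ∧ ¬ z k = true).card := by
  rw [hammingWeight_eq_sum, hammingWeight_eq_sum, Finset.card_filter, ← Finset.sum_add_distrib]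
  refine Finset.sum_congr rfl fun k _ => ?_
  have := h k
  by_cases hz : z k = true <;> by_cases hx : x k = true <;> simp_all

theorem eq_of_subset_of_hammingWeight_eq {n : ℕ} {z x : Fin n → Bool}
    (h : ∀ k, z k = true → x k = true) (hw : hammingWeight x = hammingWeight z) : x = z := by
  have h1 := hammingWeight_eq_add_card_sdiff h
  have h2 : (Finset.univ.filter fun k => x k = true ∧ ¬ z k = true) = ∅ := by
    rw [← Finset.card_eq_zero]; omega
  ext k
  have h3 : ¬ (x k = true ∧ ¬ z k = true) := fun hk => by
    have : k ∈ (Finset.univ.filter fun k => x k = true ∧ ¬ z k = true) := by simpa using hk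
    rw [h2] at this
    exact absurd this (Finset.notMem_empty k)
  have h4 := h k
  by_cases hz : z k = true <;> by_cases hx : x k = true <;> simp_all

theorem subset_update_false_iff {n : ℕ} {z x : Fin n → Bool} {m : Fin n} :
    (∀ k, z k = true → Function.update x m false k = true)
      ↔ (∀ k, z k = true → x k = true) ∧ ¬ z m = true := by
  constructor
  · intro h
    refine ⟨fun k hk => ?_, fun hm => by simpa using h m hm⟩
    have := h k hk
    by_cases hkm : k = m
    · subst hkm; simp at this
    · rwa [Function.update_of_ne hkm] at this
  · rintro ⟨h, hm⟩ k hk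
    rw [Function.update_of_ne (fun hkm : k = m => hm (hkm ▸ hk))]
    exact h k hk

/-- The value counts the orders in which the `k` elements of `x \ z` can be added to `z`. -/
theorem cubeUp_pow_single {n : ℕ} (z : Fin n → Bool) (k : ℕ) (x : Fin n → Bool) :
    (cubeUp n ^ k) (Pi.single z 1) x
      = if hammingWeight x = hammingWeight z + k ∧ ∀ m, z m = true → x m = true
        then (k.factorial : ℝ) else 0 := by
  induction k generalizing x with
  | zero =>
    rw [pow_zero, Module.End.one_apply, Pi.single_apply]
    refine if_congr ⟨?_, fun h => eq_of_subset_of_hammingWeight_eq h.2 h.1⟩ (by simp) rfl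
    rintro rfl
    exact ⟨rfl, fun _ h => h⟩
  | succ k ih =>
    rw [pow_succ', Module.End.mul_apply, cubeUp_apply]
    simp only [ih, subset_update_false_iff]
    split_ifs with h
    · have hc := hammingWeight_eq_add_card_sdiff h.2
      have : ∀ m, (if x m = true then
            (if hammingWeight (Function.update x m false) = hammingWeight z + k ∧
              (∀ k, z k = true → x k = true) ∧ ¬ z m = true then (k.factorial : ℝ) else 0) else 0)
          = if x m = true ∧ ¬ z m = true then (k.factorial : ℝ) else 0 := by
        intro m
        by_cases hx : x m = true
        · have := hammingWeight_update_false hx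
          have hw : hammingWeight (Function.update x m false) = hammingWeight z + k := by omega
          rw [if_pos hx]
          exact if_congr ⟨fun h' => ⟨hx, h'.2.2⟩, fun h' => ⟨hw, h.2, h'.2⟩⟩ rfl rfl
        · simp [hx]
      rw [Finset.sum_congr rfl fun m _ => this m, ← Finset.sum_filter, Finset.sum_const,
        show (Finset.univ.filter fun m => x m = true ∧ ¬ z m = true).card = k + 1 by omega,
        Nat.factorial_succ]
      push_cast
      simp
    · refine Finset.sum_eq_zero fun m _ => ?_
      split_ifs with hx h'
      · have := hammingWeight_update_false hx
        exact absurd ⟨by omega, h'.2.1⟩ h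
      · rfl
      · rfl

theorem single_mem_cubeLayer {n : ℕ} (z : Fin n → Bool) :
    Pi.single z 1 ∈ cubeLayer n (hammingWeight z) := fun x hx => by
  rw [Pi.single_apply, if_neg]
  rintro rfl
  exact hx rfl

theorem cubeRestrict_cubeUp_pow_single {n i : ℕ} {z : Fin n → Bool} (hz : hammingWeight z ≤ i) :
    cubeRestrict n i ((cubeUp n ^ (i - hammingWeight z)) (Pi.single z 1))
      = ((i - hammingWeight z).factorial : ℝ) • containmentFun n i z := by
  ext x
  have hx := mem_hammingSphere.mp x.2
  change (cubeUp n ^ (i - hammingWeight z)) (Pi.single z 1) x.1 = _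
  rw [cubeUp_pow_single, Pi.smul_apply, containmentFun, smul_eq_mul, mul_ite, mul_one, mul_zero]
  exact if_congr ⟨fun h => h.2, fun h => ⟨by omega, h⟩⟩ rfl rfl

/-- Up to a factorial, `g_z` is `U^(i-|z|)` applied to the point mass at `z`. For `|z| < j` this
factors through level `j`, so the point masses of weight exactly `j` already give every generator.
-/
theorem johnsonFiltration_eq {n i j : ℕ} (hj : j ≤ i) :
    johnsonFiltration n i j
      = (cubeLayer n j).map (cubeRestrict n i ∘ₗ cubeUp n ^ (i - j)) := by
  apply le_antisymm
  · refine Submodule.span_le.mpr ?_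
    rintro _ ⟨z, hz, rfl⟩
    have h1 := cubeRestrict_cubeUp_pow_single (hz.trans hj)
    have h2 : containmentFun n i z = ((i - hammingWeight z).factorial : ℝ)⁻¹ •
        (cubeRestrict n i ∘ₗ cubeUp n ^ (i - j))
          ((cubeUp n ^ (j - hammingWeight z)) (Pi.single z 1)) := by
      rw [LinearMap.comp_apply, ← Module.End.mul_apply, ← pow_add,
        show i - j + (j - hammingWeight z) = i - hammingWeight z by omega, h1,
        inv_smul_smul₀ (by positivity)]
    rw [h2]
    refine Submodule.smul_mem _ _ (Submodule.mem_map_of_mem ?_)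
    have := cubeUp_pow_mem_layer (single_mem_cubeLayer z) (j - hammingWeight z)
    rwa [show hammingWeight z + (j - hammingWeight z) = j by omega] at this
  · rintro _ ⟨f, hf, rfl⟩
    rw [pi_eq_sum_univ' f, map_sum]
    refine Submodule.sum_mem _ fun z _ => ?_
    rw [map_smul]
    by_cases hz : hammingWeight z = j
    · refine Submodule.smul_mem _ _ ?_
      have h1 := cubeRestrict_cubeUp_pow_single (hz.le.trans hj)
      rw [hz] at h1
      rw [LinearMap.comp_apply, h1]
      exact Submodule.smul_mem _ _ (Submodule.subset_span ⟨z, hz.le, rfl⟩)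
    · rw [hf z hz, zero_smul]
      exact Submodule.zero_mem _

theorem sum_cubeRestrict_mul {n i : ℕ} {f : (Fin n → Bool) → ℝ} (hf : f ∈ cubeLayer n i)
    (g : (Fin n → Bool) → ℝ) :
    ∑ x, cubeRestrict n i f x * cubeRestrict n i g x = ∑ x, f x * g x := by
  rw [← Finset.sum_subset (Finset.subset_univ (hammingSphere n i)) fun x _ hx => by
    rw [hf x (by rwa [mem_hammingSphere] at hx), zero_mul]]
  exact Finset.sum_coe_sort (hammingSphere n i) fun x => f x * g x

theorem sum_cubeUp_pow_mul_cubeUp_pow_eq_zero {n t k m : ℕ} {h : (Fin n → Bool) → ℝ}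
    (hh : h ∈ cubeHarmonic n t) (hkm : k < m) (g : (Fin n → Bool) → ℝ) :
    ∑ x, (cubeUp n ^ k) h x * (cubeUp n ^ m) g x = 0 := by
  simp_rw [mul_comm ((cubeUp n ^ k) h _)]
  rw [sum_cubeUp_pow_mul, cubeDown_pow_cubeUp_pow_eq_zero hh hkm]
  simp

/-- Level `j + 1` splits into harmonic functions and `U` of level `j`. Raised to level `i`, the
first part is orthogonal to `U_j` and the second lies in `U_j`. The second component of a vector
orthogonal to `U_j` is thus orthogonal to itself. -/
theorem johnsonEigenspace_eq {n i t : ℕ} (ht : t ≤ i) (hn : 2 * t ≤ n) :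
    johnsonEigenspace n i t
      = (cubeHarmonic n t).map (cubeRestrict n i ∘ₗ cubeUp n ^ (i - t)) := by
  cases t with
  | zero =>
    rw [johnsonEigenspace, johnsonFiltration_eq ht]
    congr 1
    exact (inf_eq_left.mpr fun f hf => cubeDown_eq_zero_of_layer_zero hf).symm
  | succ j =>
    have hpow : ∀ g, (cubeUp n ^ (i - (j + 1))) (cubeUp n g) = (cubeUp n ^ (i - j)) g := by
      intro g
      rw [← Module.End.mul_apply, ← pow_succ, show i - (j + 1) + 1 = i - j by omega]
    have horth : ∀ h ∈ cubeHarmonic n (j + 1), (cubeRestrict n i ∘ₗ cubeUp n ^ (i - (j + 1))) h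
        ∈ functionOrthogonal (johnsonFiltration n i j) := by
      intro h hh g hg
      rw [johnsonFiltration_eq (by omega)] at hg
      obtain ⟨g, -, rfl⟩ := hg
      have hl := cubeUp_pow_mem_layer hh.1 (i - (j + 1))
      rw [show j + 1 + (i - (j + 1)) = i by omega] at hl
      exact (sum_cubeRestrict_mul hl _).trans
        (sum_cubeUp_pow_mul_cubeUp_pow_eq_zero hh (by omega) g)
    apply le_antisymm
    · rintro v ⟨hv, hv'⟩
      rw [johnsonFiltration_eq ht] at hv
      obtain ⟨f, hf, rfl⟩ := hv
      rw [← cubeLayer_succ_eq_sup (by omega)] at hf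
      obtain ⟨h, hh, _, ⟨g, hg, rfl⟩, rfl⟩ := Submodule.mem_sup.mp hf
      rw [map_add] at hv' ⊢
      set w := (cubeRestrict n i ∘ₗ cubeUp n ^ (i - (j + 1))) (cubeUp n g) with hw
      have hwU : w ∈ johnsonFiltration n i j := by
        rw [johnsonFiltration_eq (by omega)]
        refine ⟨g, hg, ?_⟩
        rw [hw, LinearMap.comp_apply, LinearMap.comp_apply, hpow]
      have hw' : w ∈ functionOrthogonal (johnsonFiltration n i j) := by
        have := Submodule.sub_mem _ hv' (horth h hh)
        rwa [add_sub_cancel_left] at this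
      rw [eq_zero_of_sum_mul_self (hw' w hwU), add_zero]
      exact Submodule.mem_map_of_mem hh
    · rintro _ ⟨h, hh, rfl⟩
      refine ⟨?_, horth h hh⟩
      rw [johnsonFiltration_eq ht]
      exact Submodule.mem_map_of_mem hh.1

/-! ### Towers and the action of the operators on them -/

/-- Extension of a function on the sphere of radius `t` to all spheres of larger radius by
iterated raising, and by zero to the smaller ones. -/
def cubeTower (n t : ℕ) : ((Fin n → Bool) → ℝ) →ₗ[ℝ] ((Fin n → Bool) → ℝ) where
  toFun h x := if t ≤ hammingWeight x then (cubeUp n ^ (hammingWeight x - t)) h x else 0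
  map_add' f g := by
    ext x
    simp only [map_add, Pi.add_apply]
    split_ifs <;> simp
  map_smul' c f := by
    ext x
    simp only [map_smul, Pi.smul_apply, RingHom.id_apply]
    split_ifs <;> simp

theorem cubeTower_apply {n t : ℕ} (h : (Fin n → Bool) → ℝ) (x : Fin n → Bool) :
    cubeTower n t h x
      = if t ≤ hammingWeight x then (cubeUp n ^ (hammingWeight x - t)) h x else 0 := rfl

theorem cubeUp_weight_mul_tower {n t : ℕ} (c : ℕ → ℝ) (h : (Fin n → Bool) → ℝ)
    (x : Fin n → Bool) :
    cubeUp n (fun y => c (hammingWeight y) * cubeTower n t h y) x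
      = (if t + 1 ≤ hammingWeight x then c (hammingWeight x - 1) else 0) * cubeTower n t h x := by
  rw [cubeUp_apply, cubeTower_apply]
  by_cases hx : t + 1 ≤ hammingWeight x
  · rw [if_pos hx, if_pos (by omega),
      show hammingWeight x - t = (hammingWeight x - 1 - t) + 1 by omega, pow_succ',
      Module.End.mul_apply, cubeUp_apply, Finset.mul_sum]
    refine Finset.sum_congr rfl fun k _ => ?_
    split_ifs with hk
    · have := hammingWeight_update_false hk
      rw [cubeTower_apply, if_pos (by omega),
        show hammingWeight (Function.update x k false) = hammingWeight x - 1 by omega]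
    · simp
  · rw [if_neg hx, zero_mul]
    refine Finset.sum_eq_zero fun k _ => ?_
    split_ifs with hk
    · have := hammingWeight_update_false hk
      rw [cubeTower_apply, if_neg (by omega), mul_zero]
    · rfl

theorem cubeDown_weight_mul_tower {n t : ℕ} (c : ℕ → ℝ) {h : (Fin n → Bool) → ℝ}
    (hh : h ∈ cubeHarmonic n t) (x : Fin n → Bool) :
    cubeDown n (fun y => c (hammingWeight y) * cubeTower n t h y) x
      = c (hammingWeight x + 1) * (((hammingWeight x : ℝ) + 1 - t) * (n - t - hammingWeight x))
        * cubeTower n t h x := by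
  have key : cubeDown n (fun y => c (hammingWeight y) * cubeTower n t h y) x
      = if t ≤ hammingWeight x + 1 then c (hammingWeight x + 1) *
          cubeDown n ((cubeUp n ^ (hammingWeight x + 1 - t)) h) x else 0 := by
    rw [cubeDown_apply]
    split_ifs with hx
    · rw [cubeDown_apply, Finset.mul_sum]
      refine Finset.sum_congr rfl fun k _ => ?_
      split_ifs with hk
      · simp
      · rw [cubeTower_apply, hammingWeight_update_true hk, if_pos hx]
    · refine Finset.sum_eq_zero fun k _ => ?_
      split_ifs with hk
      · rfl
      · rw [cubeTower_apply, hammingWeight_update_true hk, if_neg hx, mul_zero]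
  rw [key, cubeTower_apply]
  by_cases hx : t ≤ hammingWeight x
  · rw [if_pos (by omega), if_pos hx,
      show hammingWeight x + 1 - t = (hammingWeight x - t) + 1 by omega,
      cubeDown_cubeUp_pow hh, Pi.smul_apply, smul_eq_mul, Nat.cast_sub hx]
    ring
  · rw [if_neg hx, mul_zero]
    -- Only the level `|x| = t - 1` is left here. The tower vanishes at `x`, and the lowered value
    -- is `D h`, which is zero.
    split_ifs with hx'
    · have hD : cubeDown n h = 0 := hh.2
      rw [show hammingWeight x + 1 - t = 0 by omega, pow_zero, Module.End.one_apply, hD,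
        Pi.zero_apply, mul_zero]
    · rfl

/-- Orthogonality holds on each level `i` separately: `D^(i-s)` annihilates `U^(i-t) h` because `i -
t < i - s`. Weights depending only on the level therefore do no harm. -/
theorem sum_weight_mul_tower_mul_tower {n s t : ℕ} (hst : s < t) (c : ℕ → ℝ)
    {h : (Fin n → Bool) → ℝ} (hh : h ∈ cubeHarmonic n t) (g : (Fin n → Bool) → ℝ) :
    ∑ x, c (hammingWeight x) * (cubeTower n t h x * cubeTower n s g x) = 0 := by
  rw [← Finset.sum_fiberwise_of_maps_to (s := Finset.univ) (t := Finset.range (n + 1))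
    (g := hammingWeight) fun x _ => Finset.mem_range.mpr (Nat.lt_succ_of_le (hammingWeight_le x))]
  refine Finset.sum_eq_zero fun i _ => ?_
  by_cases hi : t ≤ i
  · have hl := cubeUp_pow_mem_layer hh.1 (i - t)
    rw [show t + (i - t) = i by omega] at hl
    have h0 := sum_cubeUp_pow_mul_cubeUp_pow_eq_zero (m := i - s) (k := i - t) hh (by omega) g
    rw [← Finset.sum_subset (Finset.filter_subset (fun x => hammingWeight x = i) _)
      fun x _ hx => by
        rw [hl x (by simpa using hx), zero_mul]] at h0
    rw [← mul_zero (c i), ← h0, Finset.mul_sum]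
    refine Finset.sum_congr rfl fun x hx => ?_
    have hx : hammingWeight x = i := by simpa using hx
    rw [cubeTower_apply, cubeTower_apply, hx, if_pos hi, if_pos (by omega)]
  · refine Finset.sum_eq_zero fun x hx => ?_
    have hx : hammingWeight x = i := by simpa using hx
    rw [cubeTower_apply, hx, if_neg hi]
    simp

/-! ### Tridiagonal matrices have simple spectrum -/

/-- Extension by zero of a vector indexed by `Fin m` to a sequence. -/
def finExtend {m : ℕ} (v : Fin m → ℝ) (k : ℕ) : ℝ :=
  if h : k < m then v ⟨k, h⟩ else 0

theorem finExtend_coe {m : ℕ} (v : Fin m → ℝ) (i : Fin m) : finExtend v i = v i :=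
  dif_pos i.2

theorem finExtend_of_le {m : ℕ} (v : Fin m → ℝ) {k : ℕ} (hk : m ≤ k) : finExtend v k = 0 :=
  dif_neg (by omega)

/-- The symmetric tridiagonal matrix with zero diagonal and off-diagonal entries `b`. -/
def tridiagonal (m : ℕ) (b : ℕ → ℝ) : Matrix (Fin m) (Fin m) ℝ :=
  Matrix.of fun i j =>
    if (j : ℕ) = i + 1 then b i else if (i : ℕ) = j + 1 then b j else 0

theorem tridiagonal_isHermitian (m : ℕ) (b : ℕ → ℝ) : (tridiagonal m b).IsHermitian := by
  ext i j
  simp only [Matrix.conjTranspose_apply, tridiagonal, Matrix.of_apply, star_trivial]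
  split_ifs <;> first | rfl | omega

theorem tridiagonal_mulVec {m : ℕ} (b : ℕ → ℝ) (v : Fin m → ℝ) (i : Fin m) :
    (tridiagonal m b).mulVec v i
      = (if (i : ℕ) = 0 then 0 else b (i - 1) * finExtend v (i - 1))
        + b i * finExtend v (i + 1) := by
  have h1 : (tridiagonal m b).mulVec v i
      = ∑ k ∈ Finset.range m, ((if k = (i : ℕ) + 1 then b i * finExtend v k else 0)
          + (if (i : ℕ) = k + 1 then b k * finExtend v k else 0)) := by
    rw [← Fin.sum_univ_eq_sum_range (fun k : ℕ =>
      ((if k = (i : ℕ) + 1 then b i * finExtend v k else 0)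
          + (if (i : ℕ) = k + 1 then b k * finExtend v k else 0))) m]
    change ∑ j, tridiagonal m b i j * v j = _
    refine Finset.sum_congr rfl fun j _ => ?_
    simp only [tridiagonal, Matrix.of_apply, finExtend_coe]
    split_ifs <;> first | omega | simp
  rw [h1, Finset.sum_add_distrib, Finset.sum_ite_eq', add_comm]
  congr 1
  · split_ifs with hi
    · exact Finset.sum_eq_zero fun k _ => if_neg (by omega)
    · have : ∀ k, ((i : ℕ) = k + 1) = (k = i - 1) := fun k => by
        apply propext; omega
      simp only [this, Finset.sum_ite_eq']
      exact if_pos (Finset.mem_range.mpr (by omega))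
  · split_ifs with hi
    · rfl
    · rw [finExtend_of_le _ (by simpa using hi), mul_zero]

/-- Row `k` expresses `b k * v (k+1)` through earlier entries, so vanishing propagates from the
first entry. -/
theorem tridiagonal_eigenvector_eq_zero {m : ℕ} {b : ℕ → ℝ}
    (hb : ∀ k, k + 1 < m → b k ≠ 0) {l : ℝ} {v : Fin m → ℝ}
    (hv : (tridiagonal m b).mulVec v = l • v) (h0 : finExtend v 0 = 0) : v = 0 := by
  have key : ∀ k, finExtend v k = 0 := by
    intro k
    induction k using Nat.strong_induction_on with
    | _ k ih =>
      cases k with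
      | zero => exact h0
      | succ k =>
        by_cases hk : k + 1 < m
        · have h1 := congrFun hv ⟨k, by omega⟩
          rw [tridiagonal_mulVec, Pi.smul_apply, ← finExtend_coe v] at h1
          have h2 : (if k = 0 then 0 else b (k - 1) * finExtend v (k - 1)) = 0 := by
            split_ifs with h
            · rfl
            · rw [ih (k - 1) (by omega), mul_zero]
          simp only [h2, ih k (by omega), smul_zero, zero_add] at h1
          exact (mul_eq_zero.mp h1).resolve_left (hb k hk)
        · exact finExtend_of_le _ (by omega)
  ext i
  rw [← finExtend_coe v, key]
  rfl

/-- If two vectors of an orthonormal eigenbasis shared an eigenvalue, some combination of them would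
lie in the kernel of `φ` and so vanish. Pairing it with one of the two then forces `φ`, and hence
the vector itself, to be zero on the other. -/
theorem ncard_eigenvalues_of_simple {ι : Type*} [Fintype ι] [DecidableEq ι] {A : Matrix ι ι ℝ}
    (hA : A.IsHermitian) (φ : (ι → ℝ) →ₗ[ℝ] ℝ)
    (hφ : ∀ (l : ℝ) (v : ι → ℝ), A.mulVec v = l • v → φ v = 0 → v = 0) :
    {l | Module.End.HasEigenvalue (Matrix.toLin' A) l}.ncard = Fintype.card ι := by
  have h1 : {l | Module.End.HasEigenvalue (Matrix.toLin' A) l} = Set.range hA.eigenvalues := by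
    rw [← hA.spectrum_real_eq_range_eigenvalues, ← Matrix.spectrum_toLin']
    ext l
    exact Module.End.hasEigenvalue_iff_mem_spectrum
  have hinj : Function.Injective hA.eigenvalues := by
    intro i j hij
    by_contra hne
    let e : ι → ι → ℝ := fun i => ⇑(hA.eigenvectorBasis i)
    have hmul : ∀ i, A.mulVec (e i) = hA.eigenvalues i • e i := hA.mulVec_eigenvectorBasis
    have hne0 : ∀ i, e i ≠ 0 := fun i h =>
      hA.eigenvectorBasis.orthonormal.ne_zero i ((WithLp.ofLp_eq_zero 2).mp h)
    have h2 : φ (e j) • e i - φ (e i) • e j = 0 := by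
      refine hφ (hA.eigenvalues i) _ ?_ ?_
      · rw [Matrix.mulVec_sub, Matrix.mulVec_smul, Matrix.mulVec_smul, hmul, hmul, ← hij,
          smul_sub, smul_comm, smul_comm (φ (e i))]
      · simp only [map_sub, map_smul, smul_eq_mul]
        ring
    have h3 : φ (e j) • hA.eigenvectorBasis i - φ (e i) • hA.eigenvectorBasis j = 0 := by
      ext k
      exact congrFun h2 k
    have h4 := congrArg (inner ℝ (hA.eigenvectorBasis j)) h3
    rw [inner_sub_right, inner_smul_right, inner_smul_right, inner_zero_right,
      hA.eigenvectorBasis.orthonormal.2 (Ne.symm hne), real_inner_self_eq_norm_sq,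
      hA.eigenvectorBasis.orthonormal.1 j] at h4
    exact hne0 i (hφ _ _ (hmul i) (by linarith))
  rw [h1, ← Set.image_univ, Set.ncard_image_of_injective _ hinj, Set.ncard_univ,
    Nat.card_eq_fintype_card]

/-! ### The spectrum of `M_t` and the radial coefficients -/

theorem lambdaCoeff_pos {n t k : ℕ} (hk : 2 ≤ k) (hn : 2 * t + k < n + 2) :
    0 < lambdaCoeff n t k := by
  have h1 : (2 : ℝ) ≤ k := by exact_mod_cast hk
  have h2 : 2 * (t : ℝ) + k < n + 2 := by exact_mod_cast hn
  exact mul_pos (by linarith) (by linarith)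

theorem tridiagM_eq (n r₁ r₂ t : ℕ) :
    tridiagM n r₁ r₂ t = tridiagonal (r₂ - max t r₁ + 1)
      fun k => √(lambdaCoeff n t (max t r₁ - t + 2 + k)) := rfl

/-- The indices that occur lie between `2` and `r₂ - t + 1`, and `t + r₂ ≤ 2r₂ ≤ n` keeps both
factors of the coefficient positive. -/
theorem sqrt_lambdaCoeff_ne_zero {n r₁ r₂ t : ℕ} (ht : max t r₁ ≤ r₂) (hn : 2 * r₂ ≤ n) {k : ℕ}
    (hk : k + 1 < r₂ - max t r₁ + 1) : √(lambdaCoeff n t (max t r₁ - t + 2 + k)) ≠ 0 :=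
  (Real.sqrt_pos.mpr (lambdaCoeff_pos (by omega) (by omega))).ne'

theorem ncard_eigenSet {n r₁ r₂ t : ℕ} (ht : max t r₁ ≤ r₂) (hn : 2 * r₂ ≤ n) :
    (eigenSet n r₁ r₂ t).ncard = r₂ - max t r₁ + 1 := by
  rw [eigenSet, tridiagM_eq]
  refine (ncard_eigenvalues_of_simple (tridiagonal_isHermitian _ _) (LinearMap.proj 0)
    fun l v hv h0 => tridiagonal_eigenvector_eq_zero
      (fun k hk => sqrt_lambdaCoeff_ne_zero ht hn hk) hv ?_).trans (Fintype.card_fin _)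
  rw [← h0]
  exact finExtend_coe v 0

/-- `M_t` acts on coordinates with respect to normalised levels, and `b k` is the ratio of the norms
of consecutive levels of a string. Dividing the entries of an eigenvector by the products of the `b
j` gives coefficients for the unnormalised levels `U^(i-t) h`. -/
theorem exists_radial_coeff {n r₁ r₂ t : ℕ} (ht : max t r₁ ≤ r₂) (hn : 2 * r₂ ≤ n) {l : ℝ}
    (hl : l ∈ eigenSet n r₁ r₂ t) :
    ∃ c : ℕ → ℝ, (∀ i, i < max t r₁ ∨ r₂ < i → c i = 0) ∧ c (max t r₁) ≠ 0 ∧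
      ∀ i, max t r₁ ≤ i → i ≤ r₂ →
        (if i = max t r₁ then 0 else c (i - 1))
          + c (i + 1) * (((i : ℝ) + 1 - t) * (n - t - i)) = l * c i := by
  rw [eigenSet, tridiagM_eq] at hl
  set s := max t r₁ with hs
  set b : ℕ → ℝ := fun k => √(lambdaCoeff n t (s - t + 2 + k)) with hbdef
  obtain ⟨v, hv⟩ := Module.End.HasEigenvalue.exists_hasEigenvector hl
  have hv1 := hv.apply_eq_smul
  rw [Matrix.toLin'_apply] at hv1
  have hts : t ≤ s := le_max_left _ _
  have hb : ∀ k, k + 1 < r₂ - s + 1 → b k ≠ 0 := fun k hk => sqrt_lambdaCoeff_ne_zero ht hn hk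
  have hp : ∀ k, k < r₂ - s + 1 → ∏ j ∈ Finset.range k, b j ≠ 0 := fun k hk =>
    Finset.prod_ne_zero_iff.mpr fun j hj => hb j (by have := Finset.mem_range.mp hj; omega)
  refine ⟨fun i => if s ≤ i then finExtend v (i - s) / ∏ j ∈ Finset.range (i - s), b j else 0,
    ?_, ?_, ?_⟩
  · rintro i (hi | hi)
    · exact if_neg (by omega)
    · simp only
      rw [finExtend_of_le _ (by omega), zero_div, ite_self]
  · intro h0
    refine hv.2 (tridiagonal_eigenvector_eq_zero hb hv1 ?_)
    simpa using h0
  · intro i hi hi'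
    obtain ⟨k, rfl⟩ := Nat.exists_eq_add_of_le hi
    have hk : k < r₂ - s + 1 := by omega
    have h1 := congrFun hv1 ⟨k, hk⟩
    rw [tridiagonal_mulVec, Pi.smul_apply, ← finExtend_coe v, smul_eq_mul] at h1
    simp only at h1
    have hup : (if s ≤ s + k + 1 then finExtend v (s + k + 1 - s)
          / ∏ j ∈ Finset.range (s + k + 1 - s), b j else 0)
          * ((((s + k : ℕ) : ℝ) + 1 - t) * (n - t - ((s + k : ℕ) : ℝ)))
        = b k * finExtend v (k + 1) / ∏ j ∈ Finset.range k, b j := by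
      rw [if_pos (by omega), show s + k + 1 - s = k + 1 by omega]
      by_cases hk1 : k + 1 < r₂ - s + 1
      · have hsq : b k * b k = (((s + k : ℕ) : ℝ) + 1 - t) * (n - t - ((s + k : ℕ) : ℝ)) := by
          rw [hbdef]
          simp only
          rw [Real.mul_self_sqrt (lambdaCoeff_pos (by omega) (by omega)).le, lambdaCoeff]
          push_cast [hts]
          ring
        rw [← hsq, Finset.prod_range_succ]
        have := hb k hk1
        have := hp k hk
        field_simp
      -- On the top sphere the next entry is zero by the extension convention, which matches the
      -- absence of level `r₂ + 1`.
      · rw [finExtend_of_le _ (by omega)]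
        simp
    have hdown : (if s + k = s then 0 else if s ≤ s + k - 1 then finExtend v (s + k - 1 - s)
          / ∏ j ∈ Finset.range (s + k - 1 - s), b j else 0)
        = (if k = 0 then 0 else b (k - 1) * finExtend v (k - 1))
          / ∏ j ∈ Finset.range k, b j := by
      by_cases hk0 : k = 0
      · simp [hk0]
      · obtain ⟨m, rfl⟩ := Nat.exists_eq_succ_of_ne_zero hk0
        rw [if_neg (by omega), if_pos (by omega), if_neg hk0,
          show s + m.succ - 1 - s = m by omega, Nat.succ_sub_one, Nat.succ_eq_add_one,
          Finset.prod_range_succ]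
        have := hb m (by omega)
        have := hp m (by omega)
        field_simp
    simp only
    rw [hup, hdown, ← add_div, h1, if_pos (by omega), Nat.add_sub_cancel_left, mul_div_assoc]

/-! ### The adjacency matrix as raising plus lowering -/

theorem hammingDist_eq_one_iff {n : ℕ} {x y : Fin n → Bool} :
    hammingDist x y = 1 ↔ ∃ k, Function.update x k (!x k) = y := by
  rw [hammingDist, Finset.card_eq_one]
  constructor
  · rintro ⟨k, hk⟩
    refine ⟨k, ?_⟩
    ext m
    have hm : x m ≠ y m ↔ m = k := by
      have := congrArg (m ∈ ·) hk
      simpa using this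
    by_cases h : m = k
    · subst h
      have h2 : x m ≠ y m := hm.mpr rfl
      rw [Function.update_self]
      cases hx : x m <;> cases hy : y m <;> simp_all
    · rw [Function.update_of_ne h]
      by_contra h2
      exact h (hm.mp h2)
  · rintro ⟨k, rfl⟩
    refine ⟨k, ?_⟩
    ext m
    by_cases h : m = k
    · subst h
      simp
    · simp [h]

theorem shellAdjMatrix_mulVec {n r₁ r₂ : ℕ} {F : (Fin n → Bool) → ℝ}
    (hF : ∀ x, x ∉ hammingShell n r₁ r₂ → F x = 0) (x : hammingShell n r₁ r₂) :
    (shellAdjMatrix n r₁ r₂).mulVec (fun y => F y.1) x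
      = cubeUp n F x.1 + cubeDown n F x.1 := by
  have h1 : (shellAdjMatrix n r₁ r₂).mulVec (fun y => F y.1) x
      = ∑ y : hammingShell n r₁ r₂, if hammingDist x.1 y.1 = 1 then F y.1 else 0 := by
    refine Finset.sum_congr rfl fun y _ => ?_
    have h : shellAdjMatrix n r₁ r₂ x y = if hammingDist x.1 y.1 = 1 then 1 else 0 :=
      if_congr Iff.rfl rfl rfl
    change shellAdjMatrix n r₁ r₂ x y * F y.1 = _
    rw [h, ite_mul, one_mul, zero_mul]
  rw [h1, Finset.sum_coe_sort (hammingShell n r₁ r₂)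
    fun y => if hammingDist x.1 y = 1 then F y else 0,
    Finset.sum_subset (Finset.subset_univ _) fun y _ hy => by rw [hF y hy, ite_self],
    ← Finset.sum_filter]
  have h2 : (Finset.univ.filter fun y => hammingDist x.1 y = 1)
      = Finset.univ.image fun k => Function.update x.1 k (!x.1 k) := by
    ext y
    simp [hammingDist_eq_one_iff]
  rw [h2, Finset.sum_image, cubeUp_apply, cubeDown_apply, ← Finset.sum_add_distrib]
  · refine Finset.sum_congr rfl fun k _ => ?_
    by_cases hk : x.1 k = true <;> simp [hk]
  · intro k _ m _ hkm
    by_contra hne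
    have := congrFun hkm k
    simp [Function.update_of_ne hne] at this

theorem mem_hammingShell {n r₁ r₂ : ℕ} {x : Fin n → Bool} :
    x ∈ hammingShell n r₁ r₂ ↔ r₁ ≤ hammingWeight x ∧ hammingWeight x ≤ r₂ := by
  simp [hammingShell, mem_hammingSphere]

/-! ### Counting dimensions -/

theorem card_hammingShell (n r₁ r₂ : ℕ) :
    (hammingShell n r₁ r₂).card = ∑ i ∈ Finset.Icc r₁ r₂, n.choose i := by
  rw [hammingShell, Finset.card_biUnion]
  · exact Finset.sum_congr rfl fun i _ => card_hammingSphere n i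
  · intro i _ j _ hij
    refine Finset.disjoint_left.mpr fun x hx hx' => hij ?_
    rw [mem_hammingSphere] at hx hx'
    omega

theorem sum_binomDiff (n i : ℕ) : ∑ t ∈ Finset.range (i + 1), binomDiff n t = n.choose i := by
  induction i with
  | zero => simp [binomDiff]
  | succ i ih => rw [Finset.sum_range_succ, ih]; simp [binomDiff]

theorem binomDiff_pos {n t : ℕ} (ht : 2 * t ≤ n) : 0 < binomDiff n t := by
  cases t with
  | zero => simp [binomDiff]
  | succ t =>
    have h1 := Nat.choose_succ_right_eq n t
    have h2 : 0 < n.choose t := Nat.choose_pos (by omega)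
    have h3 : n.choose t * (t + 2) ≤ n.choose t * (n - t) := Nat.mul_le_mul_left _ (by omega)
    have h4 : n.choose t < n.choose (t + 1) := by
      by_contra! h
      have := Nat.mul_le_mul_right (t + 1) h
      nlinarith
    simp only [binomDiff, Nat.add_eq_zero_iff, one_ne_zero, and_false, if_false,
      Nat.add_sub_cancel]
    omega

/-- After the order of summation is exchanged, the sphere of radius `i` receives the terms with `t ≤
i`, which telescope to `C(n,i)`. -/
theorem sum_binomDiff_mul (n r₁ r₂ : ℕ) :
    ∑ t ∈ Finset.range (r₂ + 1), ((Finset.Icc (max t r₁) r₂).card : ℤ) * binomDiff n t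
      = (hammingShell n r₁ r₂).card := by
  have h1 : ∀ t, ((Finset.Icc (max t r₁) r₂).card : ℤ) * binomDiff n t
      = ∑ i ∈ Finset.Icc r₁ r₂, if t < i + 1 then binomDiff n t else 0 := by
    intro t
    rw [← Finset.sum_filter, Finset.sum_const, nsmul_eq_mul]
    congr 3
    ext i
    simp only [Finset.mem_Icc, Finset.mem_filter]
    omega
  simp_rw [h1]
  rw [Finset.sum_comm, card_hammingShell, Nat.cast_sum]
  refine Finset.sum_congr rfl fun i hi => ?_
  have hi := Finset.mem_Icc.mp hi
  rw [← sum_binomDiff, ← Finset.sum_filter]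
  refine Finset.sum_congr ?_ fun _ _ => rfl
  ext t
  simp only [Finset.mem_range, Finset.mem_filter]
  omega

/-- Independence says that summation embeds the product of the `p i` into `E`. -/
theorem sum_finrank_le_of_independent {ι V : Type*} [AddCommGroup V] [Module ℝ V]
    [FiniteDimensional ℝ V] (s : Finset ι) (p : ι → Submodule ℝ V) (E : Submodule ℝ V)
    (hE : ∀ i ∈ s, p i ≤ E)
    (hp : ∀ f : ι → V, (∀ i ∈ s, f i ∈ p i) → ∑ i ∈ s, f i = 0 → ∀ i ∈ s, f i = 0) :
    ∑ i ∈ s, Module.finrank ℝ (p i) ≤ Module.finrank ℝ E := by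
  classical
  let T : (∀ i : s, p i) →ₗ[ℝ] E :=
    ∑ i : s, Submodule.inclusion (hE i i.2) ∘ₗ LinearMap.proj i
  have hTapp : ∀ f, (T f : V) = ∑ i : s, (f i : V) := by
    intro f
    simp [T, LinearMap.sum_apply]
  have hT : Function.Injective T := by
    rw [← LinearMap.ker_eq_bot, LinearMap.ker_eq_bot']
    intro f hf
    have h0 : ∑ i : s, (f i : V) = 0 := by rw [← hTapp, hf]; rfl
    have h1 := hp (fun i => if h : i ∈ s then (f ⟨i, h⟩ : V) else 0)
      (fun i hi => by simp only [dif_pos hi]; exact (f ⟨i, hi⟩).2)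
      (by
        rw [← h0, ← Finset.sum_coe_sort s]
        exact Finset.sum_congr rfl fun i _ => dif_pos i.2)
    ext i
    have := h1 i i.2
    simpa using this
  have := LinearMap.finrank_le_finrank_of_injective hT
  rw [Module.finrank_pi_fintype] at this
  rwa [← Finset.sum_coe_sort s]

theorem sum_finrank_eigenspace_le {V : Type*} [AddCommGroup V] [Module ℝ V]
    [FiniteDimensional ℝ V] (T : Module.End ℝ V) (s : Finset ℝ) :
    ∑ l ∈ s, Module.finrank ℝ (Module.End.eigenspace T l) ≤ Module.finrank ℝ V := by
  rw [← finrank_top ℝ V]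
  exact sum_finrank_le_of_independent s _ _ (fun _ _ => le_top) fun f hf h0 =>
    (iSupIndep_iff_finsetSum_eq_zero_imp_eq_zero _).mp T.eigenspaces_iSupIndep s f hf h0

/-! ### Eigenfunctions on the shell -/

/-- The function on the shell whose restriction to the sphere of radius `i` is the `i`-th level of
the tower over `h`, multiplied by `c i`. -/
def shellTower (n r₁ r₂ t : ℕ) (c : ℕ → ℝ) :
    ((Fin n → Bool) → ℝ) →ₗ[ℝ] (hammingShell n r₁ r₂ → ℝ) where
  toFun h x := c (hammingWeight x.1) * cubeTower n t h x.1
  map_add' f g := by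
    ext x
    simp [mul_add]
  map_smul' a f := by
    ext x
    simp only [map_smul, Pi.smul_apply, smul_eq_mul, RingHom.id_apply]
    ring

theorem restrictToSphere_shellTower {n r₁ r₂ t i : ℕ} (h₁ : r₁ ≤ i) (h₂ : i ≤ r₂) (ht : t ≤ i)
    (c : ℕ → ℝ) (h : (Fin n → Bool) → ℝ) :
    restrictToSphere n h₁ h₂ (shellTower n r₁ r₂ t c h)
      = c i • (cubeRestrict n i ∘ₗ cubeUp n ^ (i - t)) h := by
  ext x
  have hx := mem_hammingSphere.mp x.2
  change c (hammingWeight x.1) * cubeTower n t h x.1 = c i * (cubeUp n ^ (i - t)) h x.1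
  rw [cubeTower_apply, hx, if_pos ht]

theorem eq_zero_of_restrictToSphere_shellTower {n r₁ r₂ t i : ℕ} (h₁ : r₁ ≤ i) (h₂ : i ≤ r₂)
    (ht : t ≤ i) (hn : t + i ≤ n) {c : ℕ → ℝ} (hc : c i ≠ 0) {h : (Fin n → Bool) → ℝ}
    (hh : h ∈ cubeHarmonic n t)
    (h0 : restrictToSphere n h₁ h₂ (shellTower n r₁ r₂ t c h) = 0) : h = 0 := by
  rw [restrictToSphere_shellTower h₁ h₂ ht, smul_eq_zero] at h0
  have hl := cubeUp_pow_mem_layer hh.1 (i - t)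
  rw [show t + (i - t) = i by omega] at hl
  exact eq_zero_of_cubeUp_pow_eq_zero hh (by omega)
    (cubeRestrict_injOn hl (h0.resolve_left hc))

theorem shellAdjMatrix_mulVec_shellTower {n r₁ r₂ t : ℕ} {l : ℝ} {c : ℕ → ℝ}
    (hc : ∀ i, i < max t r₁ ∨ r₂ < i → c i = 0)
    (hrec : ∀ i, max t r₁ ≤ i → i ≤ r₂ →
        (if i = max t r₁ then 0 else c (i - 1))
          + c (i + 1) * (((i : ℝ) + 1 - t) * (n - t - i)) = l * c i)
    {h : (Fin n → Bool) → ℝ} (hh : h ∈ cubeHarmonic n t) :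
    (shellAdjMatrix n r₁ r₂).mulVec (shellTower n r₁ r₂ t c h)
      = l • shellTower n r₁ r₂ t c h := by
  ext x
  have hx := mem_hammingShell.mp x.2
  have hF : ∀ y, y ∉ hammingShell n r₁ r₂ →
      (fun y => c (hammingWeight y) * cubeTower n t h y) y = 0 := by
    intro y hy
    rw [mem_hammingShell] at hy
    simp only
    rw [hc _ (by have := le_max_right t r₁; omega), zero_mul]
  refine (shellAdjMatrix_mulVec hF x).trans ?_
  rw [cubeUp_weight_mul_tower, cubeDown_weight_mul_tower c hh, ← add_mul]
  change _ = l * (c (hammingWeight x.1) * cubeTower n t h x.1)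
  rw [← mul_assoc l]
  by_cases hxt : t ≤ hammingWeight x.1
  · have hm : max t r₁ ≤ hammingWeight x.1 := max_le hxt hx.1
    rw [← hrec _ hm hx.2]
    congr 2
    -- On the lowest sphere nothing may come from below. If `t < r₁` the tower itself continues
    -- below the shell, and it is the vanishing of `c` there that removes the term.
    by_cases he : hammingWeight x.1 = max t r₁
    · rw [if_pos he]
      split_ifs with h1
      · exact hc _ (by omega)
      · rfl
    · rw [if_neg he, if_pos (by omega)]
  · rw [cubeTower_apply, if_neg hxt, mul_zero, mul_zero]

theorem sum_shellTower_mul_shellTower {n r₁ r₂ s t : ℕ} (hst : s ≠ t) {c d : ℕ → ℝ}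
    (hc : ∀ i, i < r₁ ∨ r₂ < i → c i = 0) {h g : (Fin n → Bool) → ℝ}
    (hh : h ∈ cubeHarmonic n t) (hg : g ∈ cubeHarmonic n s) :
    ∑ x, shellTower n r₁ r₂ t c h x * shellTower n r₁ r₂ s d g x = 0 := by
  have h1 : ∑ x, shellTower n r₁ r₂ t c h x * shellTower n r₁ r₂ s d g x
      = ∑ x, c (hammingWeight x) * d (hammingWeight x)
          * (cubeTower n t h x * cubeTower n s g x) := by
    rw [← Finset.sum_subset (Finset.subset_univ (hammingShell n r₁ r₂)) fun x _ hx => by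
      rw [mem_hammingShell] at hx
      rw [hc _ (by omega), zero_mul, zero_mul]]
    rw [← Finset.sum_coe_sort (hammingShell n r₁ r₂)]
    refine Finset.sum_congr rfl fun x _ => ?_
    change c _ * _ * (d _ * _) = _
    ring
  rw [h1]
  rcases lt_or_gt_of_ne hst with h2 | h2
  · exact sum_weight_mul_tower_mul_tower h2 (fun i => c i * d i) hh g
  · simp_rw [mul_comm (cubeTower n t h _)]
    exact sum_weight_mul_tower_mul_tower h2 (fun i => c i * d i) hg h

/-- Each `t` contributes `C(n,t) - C(n,t-1)` once for every element of `Λ_t`, that is, once for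
every sphere from `t'` to `r₂`. -/
theorem sum_multiplicitySum {n r₁ r₂ : ℕ} (h₁₂ : r₁ ≤ r₂) (h₂ : 2 * r₂ ≤ n) {T : Finset ℝ}
    (hT : ∀ t ≤ r₂, eigenSet n r₁ r₂ t ⊆ T) :
    ∑ l ∈ T, multiplicitySum n r₁ r₂ l = (hammingShell n r₁ r₂).card := by
  classical
  rw [← sum_binomDiff_mul]
  simp only [multiplicitySum, Finset.sum_filter]
  rw [Finset.sum_comm]
  refine Finset.sum_congr rfl fun t ht => ?_
  have ht : t ≤ r₂ := Nat.lt_succ_iff.mp (Finset.mem_range.mp ht)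
  rw [← Finset.sum_filter, Finset.sum_const, nsmul_eq_mul, Nat.card_Icc]
  congr 2
  rw [← Set.ncard_coe_finset, Finset.coe_filter]
  have : {l | l ∈ T ∧ l ∈ eigenSet n r₁ r₂ t} = eigenSet n r₁ r₂ t :=
    Set.ext fun l => ⟨fun h => h.2, fun h => ⟨hT t ht h, h⟩⟩
  rw [this, ncard_eigenSet (max_le ht h₁₂) h₂]
  have := max_le ht h₁₂
  omega

/-! ### The spaces `W_t(λ)` and the multiplicities -/

theorem theorem1p8 (n r₁ r₂ : ℕ) (h₁₂ : r₁ < r₂) (h₂ : 2 * r₂ ≤ n) :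
    (∃ W : ℕ → ℝ → Submodule ℝ (hammingShell n r₁ r₂ → ℝ),
      ∀ (t : ℕ) (ht : t ≤ r₂),
        (eigenSet n r₁ r₂ t).ncard = r₂ - max t r₁ + 1 ∧
        ∀ l ∈ eigenSet n r₁ r₂ t,
          W t l ≤ Module.End.eigenspace (Matrix.toLin' (shellAdjMatrix n r₁ r₂)) l ∧
          (Module.finrank ℝ (W t l) : ℤ) = binomDiff n t ∧
          (∀ (i : ℕ) (hi : max t r₁ ≤ i) (hi₂ : i ≤ r₂), ∀ f ∈ W t l,
            restrictToSphere n ((le_max_right t r₁).trans hi) hi₂ f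
              ∈ johnsonEigenspace n i t) ∧
          (∀ f ∈ W t l, ∀ x : hammingShell n r₁ r₂,
            hammingWeight x.1 < max t r₁ → f x = 0) ∧
          Submodule.map (restrictToSphere n (le_max_right t r₁) (max_le ht h₁₂.le)) (W t l)
            = johnsonEigenspace n (max t r₁) t ∧
          (∀ f ∈ W t l, ∀ g ∈ W t l,
            restrictToSphere n (le_max_right t r₁) (max_le ht h₁₂.le) f
              = restrictToSphere n (le_max_right t r₁) (max_le ht h₁₂.le) g → f = g)) ∧
    (∀ l : ℝ,
      (Module.End.HasEigenvalue (Matrix.toLin' (shellAdjMatrix n r₁ r₂)) l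
        ↔ ∃ t ≤ r₂, l ∈ eigenSet n r₁ r₂ t) ∧
      (Module.finrank ℝ
          (Module.End.eigenspace (Matrix.toLin' (shellAdjMatrix n r₁ r₂)) l) : ℤ)
        = multiplicitySum n r₁ r₂ l) := by
  classical
  have hex : ∀ (t : ℕ) (l : ℝ), t ≤ r₂ → l ∈ eigenSet n r₁ r₂ t → ∃ c : ℕ → ℝ,
      (∀ i, i < max t r₁ ∨ r₂ < i → c i = 0) ∧ c (max t r₁) ≠ 0 ∧
      ∀ i, max t r₁ ≤ i → i ≤ r₂ →
        (if i = max t r₁ then 0 else c (i - 1))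
          + c (i + 1) * (((i : ℝ) + 1 - t) * (n - t - i)) = l * c i :=
    fun t l ht hl => exists_radial_coeff (max_le ht h₁₂.le) h₂ hl
  -- For `l` outside `Λ_t` the coefficients are arbitrary, and nothing is claimed about `W t l`
  -- there.
  choose! c hc0 hc1 hrec using hex
  set W : ℕ → ℝ → Submodule ℝ (hammingShell n r₁ r₂ → ℝ) := fun t l =>
    (cubeHarmonic n t).map (shellTower n r₁ r₂ t (c t l)) with hW
  have hinj : ∀ t ≤ r₂, ∀ l ∈ eigenSet n r₁ r₂ t, ∀ (ht : max t r₁ ≤ r₂), ∀ f ∈ W t l,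
      restrictToSphere n (le_max_right t r₁) ht f = 0 → f = 0 := by
    rintro t ht l hl ht' _ ⟨h, hh, rfl⟩ h0
    rw [eq_zero_of_restrictToSphere_shellTower _ _ (le_max_left _ _) (by omega)
      (hc1 t l ht hl) hh h0, map_zero]
  have heig : ∀ t ≤ r₂, ∀ l ∈ eigenSet n r₁ r₂ t,
      W t l ≤ Module.End.eigenspace (Matrix.toLin' (shellAdjMatrix n r₁ r₂)) l := by
    rintro t ht l hl _ ⟨h, hh, rfl⟩
    rw [Module.End.mem_eigenspace_iff, Matrix.toLin'_apply]
    exact shellAdjMatrix_mulVec_shellTower (hc0 t l ht hl) (hrec t l ht hl) hh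
  have hdim : ∀ t ≤ r₂, ∀ l ∈ eigenSet n r₁ r₂ t,
      (Module.finrank ℝ (W t l) : ℤ) = binomDiff n t := by
    intro t ht l hl
    have hi : Function.Injective
        ((shellTower n r₁ r₂ t (c t l)).domRestrict (cubeHarmonic n t)) := by
      rw [← LinearMap.ker_eq_bot, LinearMap.ker_eq_bot']
      intro h hh
      have hm : max t r₁ ≤ r₂ := max_le ht h₁₂.le
      refine Subtype.ext (eq_zero_of_restrictToSphere_shellTower (le_max_right t r₁)
        hm (le_max_left _ _) (by omega) (hc1 t l ht hl) h.2 ?_)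
      rw [show shellTower n r₁ r₂ t (c t l) h.1 = 0 from hh, map_zero]
    have hrange : W t l = LinearMap.range
        ((shellTower n r₁ r₂ t (c t l)).domRestrict (cubeHarmonic n t)) :=
      (LinearMap.range_domRestrict _ _).symm
    rw [hrange, LinearMap.finrank_range_of_inj hi, finrank_cubeHarmonic (by omega)]
  refine ⟨⟨W, fun t ht => ⟨ncard_eigenSet (max_le ht h₁₂.le) h₂, fun l hl =>
    ⟨heig t ht l hl, hdim t ht l hl, ?_, ?_, ?_, ?_⟩⟩⟩, ?_⟩
  · rintro i hi hi₂ _ ⟨h, hh, rfl⟩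
    have hti : t ≤ i := (le_max_left _ _).trans hi
    rw [restrictToSphere_shellTower _ _ hti, johnsonEigenspace_eq hti (by omega)]
    exact Submodule.smul_mem _ _ (Submodule.mem_map_of_mem hh)
  · rintro _ ⟨h, hh, rfl⟩ x hx
    change c t l _ * _ = 0
    rw [hc0 t l ht hl _ (Or.inl hx), zero_mul]
  · rw [johnsonEigenspace_eq (le_max_left _ _) (by omega), hW]
    simp only
    rw [← Submodule.map_comp]
    have : restrictToSphere n (le_max_right t r₁) (max_le ht h₁₂.le) ∘ₗ
          shellTower n r₁ r₂ t (c t l)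
        = c t l (max t r₁) • (cubeRestrict n (max t r₁) ∘ₗ cubeUp n ^ (max t r₁ - t)) :=
      LinearMap.ext fun h => restrictToSphere_shellTower (le_max_right t r₁)
        (max_le ht h₁₂.le) (le_max_left _ _) _ h
    rw [this, Submodule.map_smul _ _ _ (hc1 t l ht hl)]
  · intro f hf g hg hfg
    exact sub_eq_zero.mp (hinj t ht l hl _ _ (Submodule.sub_mem _ hf hg)
      (by rw [map_sub, hfg, sub_self]))
  · set E := fun l => Module.End.eigenspace (Matrix.toLin' (shellAdjMatrix n r₁ r₂)) l with hE
    have hle : ∀ l, multiplicitySum n r₁ r₂ l ≤ (Module.finrank ℝ (E l) : ℤ) := by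
      intro l
      have hmem : ∀ t ∈ (Finset.range (r₂ + 1)).filter (fun t => l ∈ eigenSet n r₁ r₂ t),
          t ≤ r₂ ∧ l ∈ eigenSet n r₁ r₂ t := fun t ht => by
        rw [Finset.mem_filter, Finset.mem_range] at ht
        exact ⟨by omega, ht.2⟩
      have h1 := sum_finrank_le_of_independent
        ((Finset.range (r₂ + 1)).filter (fun t => l ∈ eigenSet n r₁ r₂ t)) (fun t => W t l) (E l)
        (fun t ht => heig t (hmem t ht).1 l (hmem t ht).2) (by
          intro f hf h0 t ht
          refine eq_zero_of_sum_mul_self ?_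
          have h2 : ∀ s ∈ (Finset.range (r₂ + 1)).filter (fun t => l ∈ eigenSet n r₁ r₂ t),
              s ≠ t → ∑ x, f t x * f s x = 0 := by
            intro s hs hst
            obtain ⟨h, hh, hh'⟩ := hf t ht
            obtain ⟨g, hg, hg'⟩ := hf s hs
            rw [← hh', ← hg']
            refine sum_shellTower_mul_shellTower hst (fun i hi => ?_) hh hg
            refine hc0 t l (hmem t ht).1 (hmem t ht).2 i ?_
            have := le_max_right t r₁
            omega
          -- By orthogonality the squared norm of `f t` equals its inner product with the whole sum
          -- of the `f s`, which is zero.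
          rw [← Finset.sum_eq_single_of_mem (f := fun s => ∑ x, f t x * f s x) t ht h2,
            Finset.sum_comm]
          refine Finset.sum_eq_zero fun x _ => ?_
          have h3 := congrFun h0 x
          rw [Finset.sum_apply] at h3
          rw [← Finset.mul_sum, h3, Pi.zero_apply, mul_zero])
      rw [multiplicitySum]
      refine le_trans (le_of_eq ?_) (Nat.cast_le.mpr h1)
      rw [Nat.cast_sum]
      refine Finset.sum_congr ?_ fun t ht => (hdim t (hmem t ?_).1 l (hmem t ?_).2).symm
      · ext t; simp
      · simpa using ht
      · simpa using ht
    have hfin : ∀ t ≤ r₂, (eigenSet n r₁ r₂ t).Finite := fun t ht =>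
      Set.finite_of_ncard_ne_zero (by rw [ncard_eigenSet (max_le ht h₁₂.le) h₂]; omega)
    have hfinU : (⋃ t ∈ Set.Iic r₂, eigenSet n r₁ r₂ t).Finite :=
      (Set.finite_Iic r₂).biUnion hfin
    have heq : ∀ l, (Module.finrank ℝ (E l) : ℤ) = multiplicitySum n r₁ r₂ l := by
      intro l
      -- Including `l` itself lets the comparison of totals cover a number `l` that lies in no
      -- `Λ_t`.
      set T := insert l hfinU.toFinset with hT
      have hsub : ∀ t ≤ r₂, eigenSet n r₁ r₂ t ⊆ T := by
        intro t ht μ hμ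
        rw [hT, Finset.coe_insert, Set.Finite.coe_toFinset]
        exact Set.mem_insert_of_mem _ (Set.mem_biUnion ht hμ)
      have h1 := sum_multiplicitySum h₁₂.le h₂ hsub
      have h3 : ∑ μ ∈ T, (Module.finrank ℝ (E μ) : ℤ) ≤ (hammingShell n r₁ r₂).card := by
        have := sum_finrank_eigenspace_le (Matrix.toLin' (shellAdjMatrix n r₁ r₂)) T
        rw [Module.finrank_fintype_fun_eq_card, Fintype.card_coe] at this
        exact_mod_cast this
      have h4 : ∑ μ ∈ T, multiplicitySum n r₁ r₂ μ = ∑ μ ∈ T, (Module.finrank ℝ (E μ) : ℤ) :=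
        le_antisymm (Finset.sum_le_sum fun μ _ => hle μ) (h1 ▸ h3)
      -- Termwise inequalities with equal totals are equalities.
      exact ((Finset.sum_eq_sum_iff_of_le fun μ _ => hle μ).mp h4 l
        (Finset.mem_insert_self _ _)).symm
    refine fun l => ⟨⟨fun hl => ?_, ?_⟩, heq l⟩
    · by_contra! hno
      have h0 : multiplicitySum n r₁ r₂ l = 0 := by
        refine Finset.sum_eq_zero fun t ht => ?_
        rw [Finset.mem_filter, Finset.mem_range] at ht
        exact absurd ht.2 (hno t (by omega))
      rw [← heq l, Nat.cast_eq_zero, Submodule.finrank_eq_zero] at h0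
      exact hl h0
    · rintro ⟨t, ht, hl⟩ h0
      have h1 := Submodule.finrank_mono (heig t ht l hl)
      have h2 := hdim t ht l hl
      have h3 := binomDiff_pos (n := n) (t := t) (by omega)
      have h4 : Module.finrank ℝ
          (Module.End.eigenspace (Matrix.toLin' (shellAdjMatrix n r₁ r₂)) l) = 0 := by
        rw [Submodule.finrank_eq_zero]
        exact h0
      omega
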